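/- A Rogers–Ramanujan partition is a partition (of an integer $\ge 0$, the empty partition included) in which any two consecutive parts differ by at least $2$. A string in a Rogers–Ramanujan partition $\pi$ is a maximal sequence of consecutive parts of $\pi$ in which the difference between neighbouring parts is at most $3$; thus $\pi$ decomposes uniquely into strings. Let $F_0=0$, $F_1=1$, $F_m=F_{m-1}+F_{m-2}$ for $m\ge 2$. For a string $\psi$ let $\eta(\psi)$ be the number of gaps equal to $3$ between consecutive parts of $\psi$, and define $$\omega(\psi)=\begin{cases}F_{\eta(\psi)+2}, & \text{if } 1\in\psi,\\ F_{\eta(\psi)+3}, & \text{if } 1\notin\psi,\end{cases}\qquad \omega(\pi)=\prod_{\psi}\omega(\psi),$$ where the product is over all strings $\psi$ of $\pi$ (so the empty partition has weight $1$). **Theorem 5.** For $n\ge 0$ let $A_{7,3}(n)$ denote the number of partitions of $n$ into parts $\not\equiv 0,\pm 3 \pmod 7$. Then $$A_{7,3}(n)=\sum_{\pi}\omega(\pi),$$ where the sum is over all Rogers–Ramanujan partitions $\pi$ of $n$. -/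

import Mathlib

namespace RogersRamanujan

/-- The parts of a partition, listed in increasing order (with multiplicity). -/
def sortedParts {n : ℕ} (p : n.Partition) : List ℕ :=
  p.parts.sort (· ≤ ·)

/-- A Rogers–Ramanujan partition: consecutive parts differ by at least 2. -/
def IsRogersRamanujan {n : ℕ} (p : n.Partition) : Prop :=
  (sortedParts p).IsChain (fun a b => a + 2 ≤ b)

instance {n : ℕ} : DecidablePred (IsRogersRamanujan (n := n)) := fun p =>
  inferInstanceAs (Decidable ((sortedParts p).IsChain (fun a b => a + 2 ≤ b)))

/-- The strings of a partition: the maximal runs of parts, in increasing order, in which any two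
consecutive parts differ by at most 3. -/
def strings {n : ℕ} (p : n.Partition) : List (List ℕ) :=
  (sortedParts p).splitBy (fun a b => decide (b ≤ a + 3))

/-- The number `η` of gaps equal to 3 between consecutive elements of an increasing list. -/
def numGapsThree (s : List ℕ) : ℕ :=
  (s.zip s.tail).countP (fun ab => decide (ab.2 = ab.1 + 3))

/-- The weight of a string with `η` gaps equal to 3. -/
def stringWeight (s : List ℕ) : ℕ :=
  if 1 ∈ s then Nat.fib (numGapsThree s + 2) else Nat.fib (numGapsThree s + 3)

/-- The weight of a partition: the product of the weights of its strings. -/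
def weight {n : ℕ} (p : n.Partition) : ℕ :=
  ((strings p).map stringWeight).prod

/-- The number of partitions of `n` into parts not congruent to `0`, `3` or `-3` modulo `7`. -/
def A73 (n : ℕ) : ℕ :=
  (Nat.Partition.restricted n (fun i =>
    ¬ ((i : ℤ) ≡ 0 [ZMOD 7]) ∧ ¬ ((i : ℤ) ≡ 3 [ZMOD 7]) ∧ ¬ ((i : ℤ) ≡ -3 [ZMOD 7]))).card

end RogersRamanujan

namespace RogersRamanujan

open Finset PowerSeries

/-! Fibonacci numbers count binary words without adjacent ones. Hence ω(π) counts the colourings of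
the parts of π by 0 and 1 in which a gap 2 preserves the colour, a gap 3 forbids two ones, and a
part 1 has colour 0 (`prod_stringWeight_splitBy`). Lowering all parts, or removing a part 1, gives
recurrences in the number N of parts. They are solved by q^(N²) Σ_j q^(j²) / ((q)_{N-j} (q)_j)
(`rrSeries_eq_doubleSumTerm`), so the sum over N is an Andrews–Gordon double series.

Bailey's lemma, applied three times to the unit Bailey pair, gives a finite identity
(`IsInvQFactorial.sum_doubleSumTerm`) whose limit equates that series with Θ / (q)_∞, where Θ = Σ_{r
∈ ℤ} (-1)^r q^(7r(r-1)/2 + 3r). The Jacobi triple product in base q^7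
(`IsInvQFactorial.sum_foldedTheta`) writes Θ as the product of 1 - q^i over i ≡ 0, ±3 mod 7, which
leaves the generating function of the allowed partitions. Limits are replaced by computations modulo
X^m. -/

/-- `D k` plays the role of `1 / ((1 - q) (1 - q ^ 2) ⋯ (1 - q ^ k))`. -/
structure IsInvQFactorial {A : Type*} [CommRing A] (q : A) (D : ℕ → A) : Prop where
  zero : D 0 = 1
  succ (k : ℕ) : (1 - q ^ (k + 1)) * D (k + 1) = D k
  one_sub_pow_ne_zero (k : ℕ) : 1 - q ^ (k + 1) ≠ 0

/-! ### Bailey's lemma and a finite Jacobi triple product. -/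

section Bailey

variable {A : Type*} [CommRing A] {q : A} {D : ℕ → A}

/-- The factor 1 - q^i kills the term i = 0 and turns D_i into D_{i-1}. This and its mirror image
drive the inductions on antidiagonal sums. -/
theorem IsInvQFactorial.sum_antidiagonal_fst (hD : IsInvQFactorial q D) (G : ℕ → ℕ → A) (n : ℕ) :
    ∑ p ∈ antidiagonal (n + 1), G p.1 p.2 * ((1 - q ^ p.1) * (D p.1 * D p.2)) =
      ∑ p ∈ antidiagonal n, G (p.1 + 1) p.2 * (D p.1 * D p.2) := by
  rw [Nat.sum_antidiagonal_succ]
  simp only [pow_zero, sub_self, zero_mul, mul_zero, zero_add]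
  refine sum_congr rfl fun p _ => ?_
  rw [← hD.succ p.1]
  ring

theorem IsInvQFactorial.sum_antidiagonal_snd (hD : IsInvQFactorial q D) (G : ℕ → ℕ → A) (n : ℕ) :
    ∑ p ∈ antidiagonal (n + 1), G p.1 p.2 * ((1 - q ^ p.2) * (D p.1 * D p.2)) =
      ∑ p ∈ antidiagonal n, G p.1 (p.2 + 1) * (D p.1 * D p.2) := by
  rw [Nat.sum_antidiagonal_succ']
  simp only [pow_zero, sub_self, zero_mul, mul_zero, zero_add]
  refine sum_congr rfl fun p _ => ?_
  rw [← hD.succ p.2]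
  ring

/-- The `q`-Vandermonde summation. -/
theorem IsInvQFactorial.sum_vandermonde [IsDomain A] (hD : IsInvQFactorial q D) (n s : ℕ) :
    ∑ p ∈ antidiagonal n, q ^ (p.2 ^ 2 + p.2 * s) * D (p.2 + s) * (D p.1 * D p.2) =
      D n * D (n + s) := by
  induction n generalizing s with
  | zero => simp [hD.zero]
  | succ n ih =>
    apply mul_left_cancel₀ (hD.one_sub_pow_ne_zero n)
    have h1 := hD.sum_antidiagonal_fst (fun _ j => q ^ (j ^ 2 + j * s) * D (j + s)) n
    have h2 := hD.sum_antidiagonal_snd (fun i j => q ^ i * (q ^ (j ^ 2 + j * s) * D (j + s))) n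
    have h3 : (1 - q ^ (n + 1)) * ∑ p ∈ antidiagonal (n + 1),
        q ^ (p.2 ^ 2 + p.2 * s) * D (p.2 + s) * (D p.1 * D p.2) =
        D n * D (n + s) + q ^ (n + 1 + s) * (D n * D (n + (s + 1))) := by
      rw [← ih s, ← ih (s + 1), ← h1, mul_sum, mul_sum]
      -- For i + j = n + 1, 1 - q^(n+1) = (1 - q^i) + q^i (1 - q^j). The second piece raises s to s
      -- + 1.
      trans ∑ p ∈ antidiagonal (n + 1),
          q ^ (p.2 ^ 2 + p.2 * s) * D (p.2 + s) * ((1 - q ^ p.1) * (D p.1 * D p.2)) +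
        ∑ p ∈ antidiagonal (n + 1),
          q ^ p.1 * (q ^ (p.2 ^ 2 + p.2 * s) * D (p.2 + s)) * ((1 - q ^ p.2) * (D p.1 * D p.2))
      · rw [← sum_add_distrib]
        refine sum_congr rfl fun p hp => ?_
        rw [← mem_antidiagonal.1 hp, pow_add]
        ring
      · rw [h2]
        congr 1
        refine sum_congr rfl fun p hp => ?_
        rw [← mem_antidiagonal.1 hp, show p.2 + 1 + s = p.2 + (s + 1) by ring]
        ring
    rw [h3, ← mul_assoc (1 - q ^ (n + 1)), hD.succ, show n + 1 + s = n + s + 1 by ring,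
      ← hD.succ (n + s), show n + (s + 1) = n + s + 1 by ring]
    ring

/-- Bailey's lemma at `a = 1`, for Bailey pairs folded onto `ℕ`. -/
theorem IsInvQFactorial.bailey [IsDomain A] (hD : IsInvQFactorial q D) (α : ℕ → A) (n : ℕ) :
    ∑ p ∈ antidiagonal n, q ^ p.2 ^ 2 * D p.1 *
        ∑ t ∈ antidiagonal p.2, α t.1 * (D t.2 * D (t.2 + 2 * t.1)) =
      ∑ t ∈ antidiagonal n, q ^ t.1 ^ 2 * α t.1 * (D t.2 * D (t.2 + 2 * t.1)) := by
  -- Expand each product of two D's by q-Vandermonde with s = 2a. The exponents combine as a² + d² +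
  -- 2ad = (a + d)², and the double sums agree after reindexing.
  conv_rhs =>
    simp only [← hD.sum_vandermonde, mul_sum]
  simp_rw [mul_sum]
  rw [sum_sigma', sum_sigma']
  refine sum_bij' (fun x _ => ⟨(x.2.1, x.1.1 + x.2.2), (x.1.1, x.2.2)⟩)
    (fun x _ => ⟨(x.2.1, x.1.1 + x.2.2), (x.1.1, x.2.2)⟩) ?_ ?_ ?_ ?_ ?_
  · rintro ⟨⟨a, b⟩, ⟨c, d⟩⟩ h
    simp only [mem_sigma, HasAntidiagonal.mem_antidiagonal] at h ⊢
    exact ⟨by omega, trivial⟩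
  · rintro ⟨⟨a, b⟩, ⟨c, d⟩⟩ h
    simp only [mem_sigma, HasAntidiagonal.mem_antidiagonal] at h ⊢
    exact ⟨by omega, trivial⟩
  · rintro ⟨⟨a, b⟩, ⟨c, d⟩⟩ h
    simp only [mem_sigma, HasAntidiagonal.mem_antidiagonal] at h
    simp [h.2]
  · rintro ⟨⟨a, b⟩, ⟨c, d⟩⟩ h
    simp only [mem_sigma, HasAntidiagonal.mem_antidiagonal] at h
    simp [h.2]
  · rintro ⟨⟨a, b⟩, ⟨c, d⟩⟩ h
    simp only [mem_sigma, HasAntidiagonal.mem_antidiagonal] at h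
    obtain ⟨-, rfl⟩ := h
    simp only
    ring

/-- The finite `q`-binomial theorem, in homogeneous form. -/
theorem IsInvQFactorial.sum_binomial [IsDomain A] (hD : IsInvQFactorial q D) (x y : A) (n : ℕ) :
    ∑ p ∈ antidiagonal n, x ^ p.1 * (-y) ^ p.2 * q ^ (p.2.choose 2) * (D p.1 * D p.2) =
      D n * ∏ j ∈ range n, (x - y * q ^ j) := by
  induction n with
  | zero => simp [hD.zero]
  | succ n ih =>
    apply mul_left_cancel₀ (hD.one_sub_pow_ne_zero n)
    rw [← mul_assoc, hD.succ, prod_range_succ, ← mul_assoc, ← ih, mul_sum]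
    have h1 := hD.sum_antidiagonal_fst (fun i j => x ^ i * (-y) ^ j * q ^ (j.choose 2)) n
    have h2 := hD.sum_antidiagonal_snd
      (fun i j => q ^ i * (x ^ i * (-y) ^ j * q ^ (j.choose 2))) n
    trans ∑ p ∈ antidiagonal (n + 1),
          x ^ p.1 * (-y) ^ p.2 * q ^ (p.2.choose 2) * ((1 - q ^ p.1) * (D p.1 * D p.2)) +
        ∑ p ∈ antidiagonal (n + 1),
          q ^ p.1 * (x ^ p.1 * (-y) ^ p.2 * q ^ (p.2.choose 2)) *
            ((1 - q ^ p.2) * (D p.1 * D p.2))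
    · rw [← sum_add_distrib]
      refine sum_congr rfl fun p hp => ?_
      rw [← mem_antidiagonal.1 hp, pow_add]
      ring
    · rw [h1, h2, ← sum_add_distrib, sum_mul]
      refine sum_congr rfl fun p hp => ?_
      rw [← mem_antidiagonal.1 hp, Nat.choose_succ_succ' p.2 1, Nat.choose_one_right]
      ring

/-- The coefficients of the theta series `∑ (-z) ^ r * q ^ (r (r - 1) / 2)` over `ℤ`, with the
terms `r = s` and `r = -s` combined and `w = q / z`. -/
def foldedTheta (q z w : A) (s : ℕ) : A :=
  if s = 0 then 1 else (-1) ^ s * q ^ (s.choose 2) * (z ^ s + w ^ s)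

/-- Since q = zw, a factor with j < n is -z q^j (1 - w q^(n-1-j)); a factor with j ≥ n is q^n (1 - z
q^(j-n)). -/
theorem prod_theta_factor (z w : A) (hzw : z * w = q) (n : ℕ) :
    ∏ j ∈ range (n + n), (q ^ n - z * q ^ j) =
      q ^ (n ^ 2) * q ^ (n.choose 2) * (-z) ^ n *
        ∏ j ∈ range n, ((1 - z * q ^ j) * (1 - w * q ^ j)) := by
  have h1 : ∏ j ∈ range n, (q ^ n - z * q ^ j) =
      q ^ (n.choose 2) * (-z) ^ n * ∏ j ∈ range n, (1 - w * q ^ j) := by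
    induction n with
    | zero => simp
    | succ n ih =>
      rw [prod_range_succ', prod_range_succ, Nat.choose_succ_succ' n 1, Nat.choose_one_right]
      have h : ∀ j ∈ range n, q ^ (n + 1) - z * q ^ (j + 1) = q * (q ^ n - z * q ^ j) :=
        fun j _ => by ring
      rw [prod_congr rfl h, prod_mul_distrib, ih, prod_const, card_range, pow_succ q n]
      linear_combination (-q ^ n * q ^ n * q ^ n.choose 2 * (-z) ^ n *
        ∏ j ∈ range n, (1 - w * q ^ j)) * hzw
  have h2 : ∏ j ∈ range n, (q ^ n - z * q ^ (n + j)) =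
      q ^ (n ^ 2) * ∏ j ∈ range n, (1 - z * q ^ j) := by
    have h : ∀ j ∈ range n, q ^ n - z * q ^ (n + j) = q ^ n * (1 - z * q ^ j) :=
      fun j _ => by ring
    rw [prod_congr rfl h, prod_mul_distrib, prod_const, card_range, sq, pow_mul]
  rw [prod_range_add, h1, h2, prod_mul_distrib]
  ring

theorem choose_two_add (a b : ℕ) : (a + b).choose 2 = a.choose 2 + a * b + b.choose 2 := by
  induction b with
  | zero => simp
  | succ b ih =>
    rw [← add_assoc, Nat.choose_succ_succ' (a + b) 1, Nat.choose_succ_succ' b 1, ih]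
    simp only [Nat.choose_one_right]
    ring

/-- A finite form of the Jacobi triple product identity. -/
theorem IsInvQFactorial.sum_foldedTheta [IsDomain A] (hD : IsInvQFactorial q D) {z w : A}
    (hzw : z * w = q) (hq : q ≠ 0) (n : ℕ) :
    ∑ t ∈ antidiagonal n, foldedTheta q z w t.1 * (D t.2 * D (t.2 + 2 * t.1)) =
      D (n + n) * ∏ j ∈ range n, ((1 - z * q ^ j) * (1 - w * q ^ j)) := by
  have hz : z ≠ 0 := by
    rintro rfl
    exact hq (by rw [← hzw, zero_mul])
  have hC : q ^ (n ^ 2) * q ^ (n.choose 2) * (-z) ^ n ≠ 0 :=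
    mul_ne_zero (mul_ne_zero (pow_ne_zero _ hq) (pow_ne_zero _ hq))
      (pow_ne_zero _ (neg_ne_zero.2 hz))
  -- The constant is the monomial split off by `prod_theta_factor` from the q-binomial product of
  -- length 2n at x = q^n, y = z. The binomial terms of index n + s and n - s then fold together.
  apply mul_left_cancel₀ hC
  rw [mul_left_comm, ← prod_theta_factor z w hzw, ← hD.sum_binomial, mul_sum,
    ← Nat.sum_antidiagonal_swap (n := n + n),
    Nat.sum_antidiagonal_eq_sum_range_succ_mk, Nat.sum_antidiagonal_eq_sum_range_succ_mk,
    Nat.succ_eq_add_one, Nat.succ_eq_add_one, add_assoc n n 1]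
  conv_rhs => rw [sum_range_add, ← sum_range_reflect _ n, sum_range_succ', ← add_assoc,
    ← sum_add_distrib]
  rw [sum_range_succ']
  congr 1
  · refine sum_congr rfl fun s hs => ?_
    obtain ⟨m, rfl⟩ := Nat.exists_eq_add_of_lt (mem_range.1 hs)
    have e1 : s + m + 1 - (s + 1) = m := by omega
    have e2 : s + m + 1 - 1 - s = m := by omega
    have e3 : s + m + 1 + (s + m + 1) - m = m + 2 * (s + 1) := by omega
    have e4 : s + m + 1 + (s + m + 1) - (m + 2 * (s + 1)) = m := by omega
    -- σ is the distance to the central index m + σ. Below, `a1` and `b1` treat the term of index m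
    -- + 2σ, `a2` and `b2` that of index m.
    generalize hσ : s + 1 = σ at *
    have hN : s + m + 1 = m + σ := by omega
    have e5 : m + σ + σ = m + 2 * σ := by ring
    simp only [hN] at e1 e2 e3 e4 ⊢
    have hσ0 : σ ≠ 0 := by omega
    simp only [Prod.swap, e1, e2, e3, e4, e5, foldedTheta, if_neg hσ0]
    have c1 : (m + 2 * σ).choose 2 = m.choose 2 + m * (2 * σ) +
        (σ.choose 2 + σ * σ + σ.choose 2) := by
      rw [choose_two_add, two_mul, choose_two_add]
    have c2 := choose_two_add m σ
    have c3 : σ * σ = σ.choose 2 + σ.choose 2 + σ := by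
      rw [← hσ, Nat.choose_succ_succ' s 1, Nat.choose_one_right]
      have h := Finset.sum_range_id_mul_two s
      rw [Finset.sum_range_id, ← Nat.choose_two_right] at h
      cases s with
      | zero => simp
      | succ s =>
        simp only [Nat.add_sub_cancel] at h
        nlinarith
    have a1 : q ^ ((m + σ) ^ 2) * q ^ ((m + σ).choose 2) * q ^ (σ.choose 2) =
        (q ^ (m + σ)) ^ m * q ^ ((m + 2 * σ).choose 2) := by
      rw [← pow_mul, ← pow_add, ← pow_add, ← pow_add, c1, c2]
      congr 1
      ring
    have a2 : q ^ ((m + σ) ^ 2) * q ^ ((m + σ).choose 2) * q ^ (σ.choose 2) * q ^ σ =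
        (q ^ (m + σ)) ^ (m + 2 * σ) * q ^ (m.choose 2) := by
      rw [← pow_mul, ← pow_add, ← pow_add, ← pow_add, ← pow_add, c2]
      congr 1
      linarith
    have b1 : (-z) ^ (m + σ) * ((-1) ^ σ * z ^ σ) = (-z) ^ (m + 2 * σ) := by
      rw [← mul_pow, neg_one_mul, ← pow_add, e5]
    have b2 : (-z) ^ (m + σ) * ((-1) ^ σ * w ^ σ) = (-z) ^ m * q ^ σ := by
      rw [pow_add, mul_assoc, ← mul_pow, ← mul_pow, ← hzw]
      congr 2
      ring
    linear_combination (D m * D (m + 2 * σ)) * (a1 * (-z) ^ (m + 2 * σ) + a2 * (-z) ^ m +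
      q ^ ((m + σ) ^ 2) * q ^ ((m + σ).choose 2) * q ^ (σ.choose 2) * (b1 + b2))
  · simp only [Prod.swap, foldedTheta]
    simp
    left
    ring

end Bailey

/-! ### String weights as numbers of colourings. -/

section Strings

/-- `List.splitBy` is computed by a loop with accumulators; extracting them yields a recursion at
the head of the list. -/
theorem splitByLoop_append_acc {α : Type*} (r : α → α → Bool) (l : List α) (a : α) (g : List α)
    (gs : List (List α)) :
    List.splitBy.loop r l a g gs = gs.reverse ++ List.splitBy.loop r l a g [] := by
  induction l generalizing a g gs with
  | nil => simp [List.splitBy.loop]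
  | cons b l ih =>
    simp_rw [List.splitBy.loop]
    split
    · exact ih b (a :: g) gs
    · rw [ih b [] (_ :: gs), ih b [] [_]]
      simp

theorem splitByLoop_concat {α : Type*} (r : α → α → Bool) (l : List α) (a x : α) (g : List α) :
    List.splitBy.loop r l a (g ++ [x]) [] =
      (List.splitBy.loop r l a g []).modifyHead (x :: ·) := by
  induction l generalizing a g with
  | nil => simp [List.splitBy.loop]
  | cons b l ih =>
    simp_rw [List.splitBy.loop]
    split
    · exact ih b (a :: g)
    · rw [splitByLoop_append_acc, splitByLoop_append_acc r l b [] [(a :: g).reverse]]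
      simp

theorem splitBy_cons_cons_of_rel {α : Type*} {r : α → α → Bool} {a b : α} (h : r a b = true)
    (l : List α) :
    (a :: b :: l).splitBy r = ((b :: l).splitBy r).modifyHead (a :: ·) := by
  simp only [List.splitBy, List.splitBy.loop, h]
  exact splitByLoop_concat r l b a []

theorem splitBy_cons_cons_of_not_rel {α : Type*} {r : α → α → Bool} {a b : α} (h : r a b = false)
    (l : List α) :
    (a :: b :: l).splitBy r = [a] :: (b :: l).splitBy r := by
  simp only [List.splitBy, List.splitBy.loop, h]
  rw [splitByLoop_append_acc]
  simp

/-- The numbers of colourings of the parts of an increasing list with the colours `0` and `1`, such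
that parts with difference 2 have the same colour and parts with difference 3 do not both have
colour `1`, where the smallest part has colour `0`, respectively `1`. -/
def colorings : List ℕ → ℕ × ℕ
  -- The total must be 1, the weight of the empty partition.
  | [] => (1, 0)
  | [_] => (1, 1)
  | a :: b :: l =>
    if b ≤ a + 2 then colorings (b :: l)
    else ((colorings (b :: l)).1 + (colorings (b :: l)).2,
      if b = a + 3 then (colorings (b :: l)).1
      else (colorings (b :: l)).1 + (colorings (b :: l)).2)

/-- The η gaps equal to 3 cut a string into η + 1 monochromatic blocks, whose colours form a binary
word without adjacent ones: F_{η+2} such words start with 0 and F_{η+1} with 1. Different strings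
are independent. -/
theorem splitBy_cons_and_colorings (b : ℕ) (l : List ℕ)
    (h : (b :: l).IsChain (fun x y => x + 2 ≤ y)) :
    ∃ s ss, (b :: l).splitBy (fun x y => decide (y ≤ x + 3)) = (b :: s) :: ss ∧
      colorings (b :: l) =
        (Nat.fib (numGapsThree (b :: s) + 2) *
            (ss.map fun t => Nat.fib (numGapsThree t + 3)).prod,
          Nat.fib (numGapsThree (b :: s) + 1) *
            (ss.map fun t => Nat.fib (numGapsThree t + 3)).prod) := by
  induction l generalizing b with
  | nil => exact ⟨[], [], by simp [List.splitBy, List.splitBy.loop],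
      by simp [colorings, numGapsThree]⟩
  | cons c l ih =>
    rw [List.isChain_cons_cons] at h
    obtain ⟨s, ss, h1, h2⟩ := ih c h.2
    by_cases hbc : c ≤ b + 3
    · refine ⟨c :: s, ss, ?_, ?_⟩
      · rw [splitBy_cons_cons_of_rel (by simpa using hbc), h1]
        rfl
      · rw [colorings, h2]
        by_cases hc : c = b + 3
        · have e : numGapsThree (b :: c :: s) = numGapsThree (c :: s) + 1 := by
            simp [numGapsThree, hc]
          rw [e, if_neg (by omega), if_pos hc, Nat.fib_add_two (n := numGapsThree (c :: s) + 1)]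
          ext <;> simp only
          ring
        · have e : numGapsThree (b :: c :: s) = numGapsThree (c :: s) := by
            simp [numGapsThree, hc]
          rw [e, if_pos (by omega)]
    · refine ⟨[], (c :: s) :: ss, ?_, ?_⟩
      · rw [splitBy_cons_cons_of_not_rel (by simpa using hbc), h1]
      · rw [colorings, h2, if_neg (by omega), if_neg (by omega), List.map_cons, List.prod_cons,
          Nat.fib_add_two (n := numGapsThree (c :: s) + 1)]
        ext <;> simp [numGapsThree] <;> ring

/-- The number of all colourings of an increasing list. -/
def totalColorings (l : List ℕ) : ℕ := (colorings l).1 + (colorings l).2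

/-- The number of colourings in which the part `1`, if present, has colour `0`. -/
def restrictedColorings (l : List ℕ) : ℕ :=
  if l.head? = some 1 then (colorings l).1 else totalColorings l

/-- The number of colourings that extend by a part of colour `1` placed two below the part `1`. -/
def extendableColorings (l : List ℕ) : ℕ :=
  if l.head? = some 1 then (colorings l).2
  else if l.head? = some 2 then (colorings l).1 else totalColorings l

/-- A part 1 can only head the first string, so every later string has weight F_{η+3}. -/
theorem prod_stringWeight_splitBy (l : List ℕ) (h : l.IsChain (fun x y => x + 2 ≤ y))
    (hpos : ∀ x ∈ l, 0 < x) :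
    ((l.splitBy (fun x y => decide (y ≤ x + 3))).map stringWeight).prod =
      restrictedColorings l := by
  cases l with
  | nil => simp [restrictedColorings, totalColorings, colorings]
  | cons b l =>
    obtain ⟨s, ss, h1, h2⟩ := splitBy_cons_and_colorings b l h
    have hfl := List.flatten_splitBy (fun x y => decide (y ≤ x + 3)) (b :: l)
    rw [h1, List.flatten_cons, List.cons_append, List.cons.injEq] at hfl
    have hgt : ∀ x ∈ l, 1 < x := by
      have h' := (h.imp (S := fun x y => x < y) (fun x y hxy => by omega)).pairwise
      rw [List.pairwise_cons] at h'
      intro x hx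
      have := h'.1 x hx
      have := hpos b (by simp)
      omega
    have hss : ss.map stringWeight = ss.map fun t => Nat.fib (numGapsThree t + 3) := by
      refine List.map_congr_left fun t ht => ?_
      rw [stringWeight, if_neg]
      intro h1t
      refine absurd (hgt 1 ?_) (lt_irrefl _)
      rw [← hfl.2]
      exact List.mem_append_right _ (List.mem_flatten.2 ⟨t, ht, h1t⟩)
    have hs : 1 ∉ s := by
      intro h1s
      refine absurd (hgt 1 ?_) (lt_irrefl _)
      rw [← hfl.2]
      exact List.mem_append_left _ h1s
    rw [h1, List.map_cons, List.prod_cons, hss, restrictedColorings, totalColorings, h2,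
      stringWeight]
    by_cases hb : b = 1
    · simp [hb]
    · rw [if_neg (by simp [hs, Ne.symm hb]), if_neg (by simpa using hb),
        Nat.fib_add_two (n := numGapsThree (b :: s) + 1)]
      ring

theorem colorings_map_add (k : ℕ) (l : List ℕ) : colorings (l.map (· + k)) = colorings l := by
  induction l with
  | nil => rfl
  | cons a l ih =>
    cases l with
    | nil => rfl
    | cons b l =>
      simp only [List.map_cons, colorings] at ih ⊢
      rw [ih]
      have e1 : b + k ≤ a + k + 2 ↔ b ≤ a + 2 := by omega
      have e2 : b + k = a + k + 3 ↔ b = a + 3 := by omega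
      simp only [e1, e2]

theorem totalColorings_map_add (k : ℕ) (l : List ℕ) :
    totalColorings (l.map (· + k)) = totalColorings l := by
  rw [totalColorings, colorings_map_add, totalColorings]

/-- The total, restricted and extendable counts are closed under the two moves that build a list:
raising all parts by 1, and raising them by 2 before prepending 1. -/
theorem restrictedColorings_map_succ (l : List ℕ) (hpos : ∀ x ∈ l, 0 < x) :
    restrictedColorings (l.map (· + 1)) = totalColorings l := by
  rw [restrictedColorings, totalColorings_map_add, if_neg]
  cases l with
  | nil => simp
  | cons a l =>
    have := hpos a (by simp)
    simp
    omega

theorem extendableColorings_map_succ (l : List ℕ) (hpos : ∀ x ∈ l, 0 < x) :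
    extendableColorings (l.map (· + 1)) = restrictedColorings l := by
  rw [extendableColorings, totalColorings_map_add, colorings_map_add, if_neg, restrictedColorings]
  · congr 1
    cases l <;> simp
  · cases l with
    | nil => simp
    | cons a l =>
      have := hpos a (by simp)
      simp
      omega

/-- A head 1, 2 or larger ends up at distance 2, 3 or at least 4 from the new part 1, which matches
the cases of `extendableColorings`. -/
theorem colorings_one_cons (l : List ℕ) (hpos : ∀ x ∈ l, 0 < x) :
    colorings (1 :: l.map (· + 2)) = (restrictedColorings l, extendableColorings l) := by
  cases l with
  | nil => rfl
  | cons a l =>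
    have := hpos a (by simp)
    have ih := colorings_map_add 2 (a :: l)
    simp only [List.map_cons] at ih ⊢
    rw [colorings, ih, restrictedColorings, extendableColorings, totalColorings]
    simp only [List.head?_cons, Option.some.injEq]
    split_ifs <;> first | rfl | omega

theorem totalColorings_one_cons (l : List ℕ) (hpos : ∀ x ∈ l, 0 < x) :
    totalColorings (1 :: l.map (· + 2)) = restrictedColorings l + extendableColorings l := by
  rw [totalColorings, colorings_one_cons l hpos]

theorem restrictedColorings_one_cons (l : List ℕ) (hpos : ∀ x ∈ l, 0 < x) :
    restrictedColorings (1 :: l.map (· + 2)) = restrictedColorings l := by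
  rw [restrictedColorings, colorings_one_cons l hpos]
  rfl

theorem extendableColorings_one_cons (l : List ℕ) (hpos : ∀ x ∈ l, 0 < x) :
    extendableColorings (1 :: l.map (· + 2)) = extendableColorings l := by
  rw [extendableColorings, colorings_one_cons l hpos]
  rfl

end Strings

/-! ### Generating functions by number of parts. -/

section Lists

/-- The lists of `N` positive numbers with sum `n` in which consecutive elements increase by at
least 2. -/
def rrLists (N n : ℕ) : Finset (List ℕ) :=
  ((univ : Finset n.Partition).image sortedParts).filter fun l =>
    l.IsChain (fun x y => x + 2 ≤ y) ∧ l.length = N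

theorem mem_rrLists {N n : ℕ} {l : List ℕ} :
    l ∈ rrLists N n ↔
      l.IsChain (fun x y => x + 2 ≤ y) ∧ l.length = N ∧ l.sum = n ∧ ∀ x ∈ l, 0 < x := by
  simp only [rrLists, mem_filter, mem_image, mem_univ, true_and]
  constructor
  · rintro ⟨⟨p, rfl⟩, h1, h2⟩
    refine ⟨h1, h2, ?_, ?_⟩
    · rw [sortedParts, ← Multiset.sum_coe, Multiset.sort_eq, p.parts_sum]
    · intro x hx
      exact p.parts_pos (by simpa [sortedParts] using hx)
  · rintro ⟨h1, h2, h3, h4⟩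
    refine ⟨⟨⟨(l : Multiset ℕ), fun {i} hi => h4 i (by simpa using hi), by simpa using h3⟩, ?_⟩,
      h1, h2⟩
    have hs : l.Pairwise (· ≤ ·) :=
      (h1.imp (S := fun x y => x ≤ y) (fun x y hxy => by omega)).pairwise
    simp only [sortedParts, Multiset.coe_sort]
    exact List.mergeSort_eq_self _ hs

theorem length_le_of_mem_rrLists {N n : ℕ} {l : List ℕ} (h : l ∈ rrLists N n) : N ≤ n := by
  obtain ⟨-, rfl, rfl, hpos⟩ := mem_rrLists.1 h
  exact List.length_le_sum_of_one_le l hpos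

theorem sum_weight_eq_sum_rrLists {n M : ℕ} (hM : n < M) :
    ∑ p : n.Partition with IsRogersRamanujan p, weight p =
      ∑ N ∈ range M, ∑ l ∈ rrLists N n, restrictedColorings l := by
  rw [sum_sigma']
  have hinj : Function.Injective (sortedParts (n := n)) := by
    intro p p' h
    ext1
    rw [← Multiset.sort_eq p.parts (· ≤ ·), ← Multiset.sort_eq p'.parts (· ≤ ·)]
    exact congrArg _ h
  refine sum_bij (fun p _ => ⟨(sortedParts p).length, sortedParts p⟩) ?_ ?_ ?_ ?_
  · intro p hp
    have hp' : (sortedParts p).IsChain (fun x y => x + 2 ≤ y) := (mem_filter.1 hp).2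
    have hmem : sortedParts p ∈ rrLists (sortedParts p).length n := by
      simpa [rrLists] using hp'
    rw [mem_sigma, Finset.mem_range]
    exact ⟨(length_le_of_mem_rrLists hmem).trans_lt hM, hmem⟩
  · intro p _ p' _ h
    apply hinj
    simpa using (Sigma.mk.inj_iff.1 h).2
  · rintro ⟨N, l⟩ h
    simp only [mem_sigma, rrLists, mem_filter, mem_image, mem_univ, true_and] at h
    obtain ⟨-, ⟨p, rfl⟩, h1, rfl⟩ := h
    exact ⟨p, mem_filter.2 ⟨mem_univ _, h1⟩, rfl⟩
  · intro p hp
    have hp' := (mem_filter.1 hp).2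
    rw [weight, strings, prod_stringWeight_splitBy _ hp']
    intro x hx
    exact p.parts_pos (by simpa [sortedParts] using hx)

theorem map_add_mem_rrLists_iff {N n k : ℕ} {l : List ℕ} (hpos : ∀ x ∈ l, 0 < x) :
    l.map (· + k) ∈ rrLists N (n + k * N) ↔ l ∈ rrLists N n := by
  have hs : (l.map (· + k)).sum = l.sum + k * l.length := by
    clear hpos
    induction l with
    | nil => simp
    | cons a l ih =>
      simp only [List.map_cons, List.sum_cons, ih, List.length_cons]
      ring
  have hc : (fun x y => x + k + 2 ≤ y + k) = (fun x y : ℕ => x + 2 ≤ y) := by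
    ext x y
    omega
  have hp : ∀ x ∈ l.map (· + k), 0 < x := by
    intro x hx
    obtain ⟨y, hy, rfl⟩ := List.mem_map.1 hx
    have := hpos y hy
    omega
  simp only [mem_rrLists, List.isChain_map, List.length_map, hc, hs]
  constructor
  · rintro ⟨h1, rfl, h3, -⟩
    exact ⟨h1, rfl, by omega, hpos⟩
  · rintro ⟨h1, rfl, h3, -⟩
    exact ⟨h1, rfl, by omega, hp⟩

theorem sum_rrLists_filter_lt {R : Type*} [AddCommMonoid R] (f : List ℕ → R) (N n k : ℕ) :
    ∑ l ∈ rrLists N n with ∀ x ∈ l, k < x, f l =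
      if k * N ≤ n then ∑ l ∈ rrLists N (n - k * N), f (l.map (· + k)) else 0 := by
  have key : ∀ l : List ℕ, (∀ x ∈ l, k < x) →
      ∃ l' : List ℕ, (∀ x ∈ l', 0 < x) ∧ l'.map (· + k) = l := by
    intro l hl
    refine ⟨l.map (· - k), ?_, ?_⟩
    · intro x hx
      obtain ⟨y, hy, rfl⟩ := List.mem_map.1 hx
      have := hl y hy
      omega
    · rw [List.map_map]
      conv_rhs => rw [← List.map_id l]
      refine List.map_congr_left fun x hx => ?_
      have := hl x hx
      simp only [Function.comp, id]
      omega
  split_ifs with hn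
  · obtain ⟨m, rfl⟩ := Nat.exists_eq_add_of_le' hn
    rw [Nat.add_sub_cancel]
    symm
    refine sum_bij (fun l _ => l.map (· + k)) ?_ ?_ ?_ (fun _ _ => rfl)
    · intro l hl
      have hpos := (mem_rrLists.1 hl).2.2.2
      refine mem_filter.2 ⟨(map_add_mem_rrLists_iff hpos).2 hl, ?_⟩
      intro x hx
      obtain ⟨y, hy, rfl⟩ := List.mem_map.1 hx
      have := hpos y hy
      omega
    · intro l _ l' _ h
      exact List.map_injective_iff.2 (add_left_injective k) h
    · intro l hl
      obtain ⟨hl, hk⟩ := mem_filter.1 hl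
      obtain ⟨l', hpos, rfl⟩ := key l hk
      exact ⟨l', (map_add_mem_rrLists_iff hpos).1 hl, rfl⟩
  · refine sum_eq_zero fun l hl => absurd ?_ hn
    obtain ⟨hl, hk⟩ := mem_filter.1 hl
    obtain ⟨-, rfl, rfl, -⟩ := mem_rrLists.1 hl
    rw [mul_comm, ← smul_eq_mul]
    exact List.card_nsmul_le_sum l k fun x hx => (hk x hx).le

theorem one_cons_mem_rrLists_iff {N n : ℕ} {l : List ℕ} :
    1 :: l ∈ rrLists (N + 1) (n + 1) ↔ l ∈ rrLists N n ∧ ∀ x ∈ l, 2 < x := by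
  simp only [mem_rrLists, List.length_cons, List.sum_cons, List.mem_cons]
  constructor
  · rintro ⟨h1, h2, h3, h4⟩
    refine ⟨⟨h1.tail, by omega, by omega, fun x hx => h4 x (Or.inr hx)⟩, ?_⟩
    cases l with
    | nil => simp
    | cons a l =>
      rw [List.isChain_cons_cons] at h1
      have h' := (h1.2.imp (S := fun x y => x < y) (fun x y hxy => by omega)).pairwise
      intro x hx
      rcases List.mem_cons.1 hx with rfl | hx
      · omega
      · have := (List.pairwise_cons.1 h').1 x hx
        omega
  · rintro ⟨⟨h1, h2, h3, h4⟩, h5⟩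
    refine ⟨?_, by omega, by omega, ?_⟩
    · cases l with
      | nil => simp
      | cons a l => exact List.isChain_cons_cons.2 ⟨h5 a (by simp), h1⟩
    · rintro x (rfl | hx)
      · exact one_pos
      · exact h4 x hx

theorem sum_rrLists_filter_head {R : Type*} [AddCommMonoid R] (f : List ℕ → R) (N n : ℕ) :
    ∑ l ∈ rrLists (N + 1) n with ¬ ∀ x ∈ l, 1 < x, f l =
      if 2 * N + 1 ≤ n then ∑ l ∈ rrLists N (n - (2 * N + 1)), f (1 :: l.map (· + 2)) else 0 := by
  cases n with
  | zero =>
    rw [if_neg (by omega)]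
    refine sum_eq_zero fun l hl => absurd (length_le_of_mem_rrLists (mem_filter.1 hl).1) (by omega)
  | succ n =>
    rw [Nat.add_sub_add_right]
    simp only [Nat.add_le_add_iff_right]
    rw [← sum_rrLists_filter_lt (fun l => f (1 :: l)) N n 2]
    symm
    refine sum_bij (fun l _ => 1 :: l) ?_ ?_ ?_ (fun _ _ => rfl)
    · intro l hl
      exact mem_filter.2 ⟨one_cons_mem_rrLists_iff.2 (mem_filter.1 hl), by simp⟩
    · intro l _ l' _ h
      exact List.tail_eq_of_cons_eq h
    · intro l hl
      obtain ⟨hl, hk⟩ := mem_filter.1 hl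
      have hl' := mem_rrLists.1 hl
      cases l with
      | nil => simp at hk
      | cons a l =>
        have ha : a = 1 := by
          by_contra ha
          have h' := (hl'.1.imp (S := fun x y => x < y) (fun x y hxy => by omega)).pairwise
          have h0 := hl'.2.2.2 a (by simp)
          refine hk fun x hx => ?_
          rcases List.mem_cons.1 hx with rfl | hx
          · omega
          · have := (List.pairwise_cons.1 h').1 x hx
            omega
        subst ha
        exact ⟨l, mem_filter.2 (one_cons_mem_rrLists_iff.1 hl), rfl⟩

/-- The generating function of the lists in `rrLists N n`, `n : ℕ`, with weights `f`. -/
noncomputable def rrSeries (N : ℕ) (f : List ℕ → ℕ) : ℚ⟦X⟧ :=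
  PowerSeries.mk fun n => ((∑ l ∈ rrLists N n, f l : ℕ) : ℚ)

theorem rrSeries_congr {N : ℕ} {f g : List ℕ → ℕ} (h : ∀ l, (∀ x ∈ l, 0 < x) → f l = g l) :
    rrSeries N f = rrSeries N g := by
  ext n
  simp only [rrSeries, coeff_mk]
  congr 1
  exact sum_congr rfl fun l hl => h l (mem_rrLists.1 hl).2.2.2

theorem rrSeries_add (N : ℕ) (f g : List ℕ → ℕ) :
    rrSeries N (fun l => f l + g l) = rrSeries N f + rrSeries N g := by
  ext n
  simp [rrSeries, sum_add_distrib]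

theorem rrSeries_zero (f : List ℕ → ℕ) : rrSeries 0 f = C (f [] : ℚ) := by
  have h : ∀ n, rrLists 0 n = if n = 0 then {[]} else ∅ := by
    intro n
    ext l
    rw [mem_rrLists]
    split_ifs with hn
    · rw [mem_singleton]
      constructor
      · exact fun h => List.length_eq_zero_iff.1 h.2.1
      · rintro rfl
        simp [hn]
    · simp only [notMem_empty, iff_false]
      rintro ⟨-, h2, rfl, -⟩
      rw [List.length_eq_zero_iff] at h2
      simp [h2] at hn
  ext n
  rw [rrSeries, coeff_mk, coeff_C, h n]
  split_ifs <;> simp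

/-- If all parts exceed 1, lowering each by 1 removes N + 1. Otherwise deleting the part 1 and
lowering the other N parts by 2 removes 2N + 1. -/
theorem rrSeries_succ (N : ℕ) (f : List ℕ → ℕ) :
    rrSeries (N + 1) f = X ^ (N + 1) * rrSeries (N + 1) (fun l => f (l.map (· + 1))) +
      X ^ (2 * N + 1) * rrSeries N (fun l => f (1 :: l.map (· + 2))) := by
  ext n
  rw [map_add, coeff_X_pow_mul', coeff_X_pow_mul']
  simp only [rrSeries, coeff_mk]
  rw [← sum_filter_add_sum_filter_not (rrLists (N + 1) n) (fun l => ∀ x ∈ l, 1 < x),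
    sum_rrLists_filter_lt, sum_rrLists_filter_head, one_mul]
  push_cast
  rfl

theorem rrSeries_restricted_succ (N : ℕ) :
    rrSeries (N + 1) restrictedColorings = X ^ (N + 1) * rrSeries (N + 1) totalColorings +
      X ^ (2 * N + 1) * rrSeries N restrictedColorings := by
  rw [rrSeries_succ, rrSeries_congr restrictedColorings_map_succ,
    rrSeries_congr restrictedColorings_one_cons]

theorem rrSeries_total_succ (N : ℕ) :
    rrSeries (N + 1) totalColorings = X ^ (N + 1) * rrSeries (N + 1) totalColorings +
      X ^ (2 * N + 1) * (rrSeries N restrictedColorings + rrSeries N extendableColorings) := by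
  conv_lhs => rw [rrSeries_succ, rrSeries_congr fun l _ => totalColorings_map_add 1 l,
    rrSeries_congr totalColorings_one_cons, rrSeries_add]

theorem rrSeries_extendable_succ (N : ℕ) :
    rrSeries (N + 1) extendableColorings = X ^ (N + 1) * rrSeries (N + 1) restrictedColorings +
      X ^ (2 * N + 1) * rrSeries N extendableColorings := by
  rw [rrSeries_succ, rrSeries_congr extendableColorings_map_succ,
    rrSeries_congr extendableColorings_one_cons]

/-! ### The same recurrences for the double sums. -/

/-- `q ^ (N ^ 2) * ∑ j, q ^ (e j) / ((q)_{N - j} (q)_j)`. -/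
def doubleSumTerm {A : Type*} [CommRing A] (q : A) (D : ℕ → A) (e : ℕ → ℕ) (N : ℕ) : A :=
  q ^ (N ^ 2) * ∑ p ∈ antidiagonal N, q ^ e p.2 * (D p.1 * D p.2)

/-- For i + j = N + 1, q^(j²) = q^(N+1) q^(j(j-1)) + q^(j²) (1 - q^i). -/
theorem doubleSumTerm_sq_succ {A : Type*} [CommRing A] {q : A} {D : ℕ → A}
    (hD : IsInvQFactorial q D) (N : ℕ) :
    doubleSumTerm q D (fun j => j ^ 2) (N + 1) =
      q ^ (N + 1) * doubleSumTerm q D (fun j => j * (j - 1)) (N + 1) +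
        q ^ (2 * N + 1) * doubleSumTerm q D (fun j => j ^ 2) N := by
  have h := hD.sum_antidiagonal_fst (fun _ j => q ^ (j ^ 2)) N
  have h' : ∑ p ∈ antidiagonal (N + 1), q ^ p.2 ^ 2 * (D p.1 * D p.2) =
      q ^ (N + 1) * ∑ p ∈ antidiagonal (N + 1), q ^ (p.2 * (p.2 - 1)) * (D p.1 * D p.2) +
      ∑ p ∈ antidiagonal N, q ^ p.2 ^ 2 * (D p.1 * D p.2) := by
    rw [← h, mul_sum, ← sum_add_distrib]
    refine sum_congr rfl fun p hp => ?_
    have e : p.2 ^ 2 = p.2 + p.2 * (p.2 - 1) := by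
      cases p.2 <;> simp; ring
    rw [← HasAntidiagonal.mem_antidiagonal.1 hp, e, pow_add, pow_add]
    ring
  simp only [doubleSumTerm]
  rw [h']
  ring

/-- Multiply q^(j(j-1)) by 1 - q^(N+1) = (1 - q^j) + q^j (1 - q^i), where i + j = N + 1. -/
theorem doubleSumTerm_sub_succ {A : Type*} [CommRing A] {q : A} {D : ℕ → A}
    (hD : IsInvQFactorial q D) (N : ℕ) :
    doubleSumTerm q D (fun j => j * (j - 1)) (N + 1) =
      q ^ (N + 1) * doubleSumTerm q D (fun j => j * (j - 1)) (N + 1) +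
        q ^ (2 * N + 1) * (doubleSumTerm q D (fun j => j ^ 2) N +
          doubleSumTerm q D (fun j => j * (j + 1)) N) := by
  have h1 := hD.sum_antidiagonal_fst (fun _ j => q ^ (j ^ 2)) N
  have h2 := hD.sum_antidiagonal_snd (fun _ j => q ^ (j * (j - 1))) N
  simp only [Nat.add_sub_cancel] at h2
  have h' : ∑ p ∈ antidiagonal (N + 1), q ^ (p.2 * (p.2 - 1)) * (D p.1 * D p.2) =
      q ^ (N + 1) * ∑ p ∈ antidiagonal (N + 1), q ^ (p.2 * (p.2 - 1)) * (D p.1 * D p.2) +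
      (∑ p ∈ antidiagonal N, q ^ p.2 ^ 2 * (D p.1 * D p.2) +
        ∑ p ∈ antidiagonal N, q ^ (p.2 * (p.2 + 1)) * (D p.1 * D p.2)) := by
    have h3 : ∑ p ∈ antidiagonal N, q ^ (p.2 * (p.2 + 1)) * (D p.1 * D p.2) =
        ∑ p ∈ antidiagonal N, q ^ ((p.2 + 1) * p.2) * (D p.1 * D p.2) :=
      sum_congr rfl fun p _ => by rw [mul_comm p.2]
    rw [h3, ← h1, ← h2, mul_sum, ← sum_add_distrib, ← sum_add_distrib]
    refine sum_congr rfl fun p hp => ?_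
    have e : p.2 ^ 2 = p.2 + p.2 * (p.2 - 1) := by
      cases p.2 <;> simp; ring
    rw [← HasAntidiagonal.mem_antidiagonal.1 hp, e, pow_add, pow_add]
    ring
  simp only [doubleSumTerm]
  conv_lhs => rw [h']
  ring

theorem doubleSumTerm_add_succ {A : Type*} [CommRing A] {q : A} {D : ℕ → A}
    (hD : IsInvQFactorial q D) (N : ℕ) :
    doubleSumTerm q D (fun j => j * (j + 1)) (N + 1) =
      q ^ (N + 1) * doubleSumTerm q D (fun j => j ^ 2) (N + 1) +
        q ^ (2 * N + 1) * doubleSumTerm q D (fun j => j * (j + 1)) N := by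
  have h := hD.sum_antidiagonal_fst (fun _ j => q ^ (j * (j + 1))) N
  have h' : ∑ p ∈ antidiagonal (N + 1), q ^ (p.2 * (p.2 + 1)) * (D p.1 * D p.2) =
      q ^ (N + 1) * ∑ p ∈ antidiagonal (N + 1), q ^ p.2 ^ 2 * (D p.1 * D p.2) +
      ∑ p ∈ antidiagonal N, q ^ (p.2 * (p.2 + 1)) * (D p.1 * D p.2) := by
    rw [← h, mul_sum, ← sum_add_distrib]
    refine sum_congr rfl fun p hp => ?_
    have e : p.2 * (p.2 + 1) = p.2 + p.2 ^ 2 := by ring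
    rw [← HasAntidiagonal.mem_antidiagonal.1 hp, e, pow_add, pow_add]
    ring
  simp only [doubleSumTerm]
  rw [h']
  ring

theorem rrSeries_eq_doubleSumTerm {D : ℕ → ℚ⟦X⟧} (hD : IsInvQFactorial X D) (N : ℕ) :
    rrSeries N restrictedColorings = doubleSumTerm X D (fun j => j ^ 2) N ∧
      rrSeries N extendableColorings = doubleSumTerm X D (fun j => j * (j + 1)) N := by
  induction N with
  | zero =>
    rw [rrSeries_zero, rrSeries_zero]
    simp [doubleSumTerm, hD.zero, restrictedColorings, extendableColorings, totalColorings,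
      colorings]
  | succ N ih =>
    have hU : rrSeries (N + 1) totalColorings =
        doubleSumTerm X D (fun j => j * (j - 1)) (N + 1) := by
      -- The total series for N + 1 occurs on both sides of its recurrence, so it is determined
      -- after cancelling 1 - q^(N+1).
      apply mul_left_cancel₀ (hD.one_sub_pow_ne_zero N)
      have h1 := rrSeries_total_succ N
      have h2 := doubleSumTerm_sub_succ hD N
      rw [ih.1, ih.2] at h1
      linear_combination h1 - h2
    have hT : rrSeries (N + 1) restrictedColorings =
        doubleSumTerm X D (fun j => j ^ 2) (N + 1) := by
      rw [rrSeries_restricted_succ, hU, ih.1, doubleSumTerm_sq_succ hD]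
    exact ⟨hT, by rw [rrSeries_extendable_succ, hT, ih.2, doubleSumTerm_add_succ hD]⟩

end Lists

/-! ### Limits as congruences modulo X^m. -/

section Truncation

theorem mk_eq_mk_iff_coeff {R : Type*} [CommRing R] (m : ℕ) (f g : R⟦X⟧) :
    Ideal.Quotient.mk (Ideal.span {(X : R⟦X⟧) ^ m}) f =
      Ideal.Quotient.mk (Ideal.span {(X : R⟦X⟧) ^ m}) g ↔ ∀ k < m, coeff k f = coeff k g := by
  rw [Ideal.Quotient.eq, Ideal.mem_span_singleton, X_pow_dvd_iff]
  simp only [map_sub, sub_eq_zero]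

theorem mk_eq_zero_of_dvd {R : Type*} [CommRing R] {m k : ℕ} (h : m ≤ k) {f : R⟦X⟧}
    (hf : X ^ k ∣ f) : Ideal.Quotient.mk (Ideal.span {(X : R⟦X⟧) ^ m}) f = 0 := by
  rw [Ideal.Quotient.eq_zero_iff_mem, Ideal.mem_span_singleton]
  exact (pow_dvd_pow X h).trans hf

/-- On the antidiagonal of 2m either s ≥ m, and c_s vanishes modulo X^m, or the other index is at
least m, and G has reached its stable value g. -/
theorem mk_sum_antidiagonal {R : Type*} [CommRing R] {m : ℕ} {c : ℕ → R⟦X⟧}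
    (hc : ∀ s, X ^ s ∣ c s) {G : ℕ → ℕ → R⟦X⟧}
    {g : R⟦X⟧ ⧸ Ideal.span {(X : R⟦X⟧) ^ m}}
    (hG : ∀ s k, m ≤ k → Ideal.Quotient.mk (Ideal.span {(X : R⟦X⟧) ^ m}) (G s k) = g) :
    Ideal.Quotient.mk (Ideal.span {(X : R⟦X⟧) ^ m})
        (∑ t ∈ antidiagonal (m + m), c t.1 * G t.1 t.2) =
      (∑ s ∈ range (m + m + 1), Ideal.Quotient.mk (Ideal.span {(X : R⟦X⟧) ^ m}) (c s)) * g := by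
  rw [Nat.sum_antidiagonal_eq_sum_range_succ_mk, map_sum, sum_mul]
  refine sum_congr rfl fun s hs => ?_
  rw [map_mul]
  by_cases h : m ≤ s
  · rw [mk_eq_zero_of_dvd h (hc s), zero_mul, zero_mul]
  · rw [hG s _ (by omega)]

end Truncation

/-! ### Inverse q-factorials as power series. -/

section InvQFactorial

/-- `1 / ((1 - q) (1 - q ^ 2) ⋯ (1 - q ^ k))` as a power series. -/
noncomputable def invQFactorial (q : ℚ⟦X⟧) (k : ℕ) : ℚ⟦X⟧ :=
  (∏ j ∈ range k, (1 - q ^ (j + 1)))⁻¹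

theorem invQFactorial_mul_prod {q : ℚ⟦X⟧} (hq : constantCoeff q = 0) (k : ℕ) :
    invQFactorial q k * ∏ j ∈ range k, (1 - q ^ (j + 1)) = 1 := by
  apply PowerSeries.inv_mul_cancel
  simp [map_prod, hq]

theorem isInvQFactorial_invQFactorial {q : ℚ⟦X⟧} (hq : constantCoeff q = 0) :
    IsInvQFactorial q (invQFactorial q) where
  zero := by simpa using invQFactorial_mul_prod hq 0
  succ k := by
    have h1 := invQFactorial_mul_prod hq k
    have h2 := invQFactorial_mul_prod hq (k + 1)
    rw [prod_range_succ] at h2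
    linear_combination invQFactorial q k * h2 -
      (1 - q ^ (k + 1)) * invQFactorial q (k + 1) * h1
  one_sub_pow_ne_zero k h := by
    simpa [hq] using congrArg constantCoeff h

theorem mk_invQFactorial {b m k : ℕ} (hb : 1 ≤ b) (hk : m ≤ k) :
    Ideal.Quotient.mk (Ideal.span {(X : ℚ⟦X⟧) ^ m}) (invQFactorial (X ^ b) k) =
      Ideal.Quotient.mk (Ideal.span {(X : ℚ⟦X⟧) ^ m}) (invQFactorial (X ^ b) m) := by
  induction k, hk using Nat.le_induction with
  | base => rfl
  | succ k hk ih =>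
    have hq : constantCoeff ((X : ℚ⟦X⟧) ^ b) = 0 := by
      simp [show b ≠ 0 by omega]
    have hdvd : X ^ (k + 1) ∣ ((X : ℚ⟦X⟧) ^ b) ^ (k + 1) * invQFactorial (X ^ b) (k + 1) := by
      rw [← pow_mul]
      exact Dvd.dvd.mul_right (pow_dvd_pow X (Nat.le_mul_of_pos_left _ hb)) _
    rw [← ih, ← (isInvQFactorial_invQFactorial hq).succ k, sub_mul, one_mul, map_sub,
      mk_eq_zero_of_dvd (by omega) hdvd, sub_zero]

end InvQFactorial

/-! ### The Bailey chain from the unit pair to the modulus 7. -/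

section BaileyChain

variable {A : Type*} [CommRing A] {q : A} {D : ℕ → A}

/-- At z = 1 and n > 0 the triple product contains the factor 1 - z = 0. -/
theorem IsInvQFactorial.unit_pair [IsDomain A] (hD : IsInvQFactorial q D) (hq : q ≠ 0) (n : ℕ) :
    ∑ t ∈ antidiagonal n, foldedTheta q 1 q t.1 * (D t.2 * D (t.2 + 2 * t.1)) =
      if n = 0 then 1 else 0 := by
  rw [hD.sum_foldedTheta (one_mul q) hq]
  cases n with
  | zero => simp [hD.zero]
  | succ n => rw [prod_range_succ']; simp

/-- Three Bailey steps contribute the exponent 3s² = 6 · s(s-1)/2 + 3s. -/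
theorem foldedTheta_seven (q : A) (s : ℕ) :
    q ^ s ^ 2 * (q ^ s ^ 2 * (q ^ s ^ 2 * foldedTheta q 1 q s)) =
      foldedTheta (q ^ 7) (q ^ 3) (q ^ 4) s := by
  unfold foldedTheta
  split_ifs with hs
  · simp [hs]
  · have h : s ^ 2 = 2 * s.choose 2 + s := by
      have h := choose_two_add s s
      have h2 := Finset.sum_range_id_mul_two s
      rw [Finset.sum_range_id, ← Nat.choose_two_right] at h2
      obtain ⟨r, rfl⟩ := Nat.exists_eq_succ_of_ne_zero hs
      simp only [Nat.succ_eq_add_one, Nat.add_sub_cancel] at h2 ⊢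
      nlinarith
    rw [h]
    ring

theorem IsInvQFactorial.sum_doubleSumTerm [IsDomain A] (hD : IsInvQFactorial q D) (hq : q ≠ 0) (n : ℕ) :
    ∑ p ∈ antidiagonal n, doubleSumTerm q D (fun j => j ^ 2) p.1 * D p.2 =
      ∑ t ∈ antidiagonal n,
        foldedTheta (q ^ 7) (q ^ 3) (q ^ 4) t.1 * (D t.2 * D (t.2 + 2 * t.1)) := by
  have h1 : ∀ n, ∑ t ∈ antidiagonal n,
      (q ^ t.1 ^ 2 * foldedTheta q 1 q t.1) * (D t.2 * D (t.2 + 2 * t.1)) = D n := by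
    intro n
    -- The unit pair leaves only the term with second index 0, so one Bailey step produces β_n =
    -- D_n.
    rw [← hD.bailey, sum_eq_single (n, 0)]
    · simp [foldedTheta, hD.zero]
    · rintro ⟨a, b⟩ hp hne
      rw [hD.unit_pair hq, if_neg, mul_zero]
      rintro rfl
      exact hne (by simpa using hp)
    · simp
  have h2 := fun n => hD.bailey (fun s => q ^ s ^ 2 * foldedTheta q 1 q s) n
  have h3 := hD.bailey (fun s => q ^ s ^ 2 * (q ^ s ^ 2 * foldedTheta q 1 q s)) n
  simp only [h1] at h2
  simp only [← h2] at h3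
  simp only [foldedTheta_seven] at h3
  rw [← h3, ← Nat.sum_antidiagonal_swap]
  refine sum_congr rfl fun p _ => ?_
  simp only [doubleSumTerm, Prod.swap, mul_assoc]
  rw [mul_comm (D p.1), ← mul_assoc]

end BaileyChain

/-! ### The infinite product for the allowed parts. -/

section Product

/-- The residue condition defining `A73`. -/
abbrev IsAllowedPart (i : ℕ) : Prop :=
  ¬ ((i : ℤ) ≡ 0 [ZMOD 7]) ∧ ¬ ((i : ℤ) ≡ 3 [ZMOD 7]) ∧ ¬ ((i : ℤ) ≡ -3 [ZMOD 7])

/-- Each block of seven consecutive integers contributes its residues 3, 4 and 0. -/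
theorem prod_not_isAllowedPart {A : Type*} [CommRing A] (q : A) (M : ℕ) :
    ∏ i ∈ range (7 * M), (if IsAllowedPart (i + 1) then 1 else 1 - q ^ (i + 1)) =
      (∏ j ∈ range M, (1 - (q ^ 7) ^ (j + 1))) *
        ∏ j ∈ range M, ((1 - q ^ 3 * (q ^ 7) ^ j) * (1 - q ^ 4 * (q ^ 7) ^ j)) := by
  induction M with
  | zero => simp
  | succ M ih =>
    have h : ∀ r : ℕ, IsAllowedPart (7 * M + r) ↔ IsAllowedPart r := by
      intro r
      simp only [IsAllowedPart, Int.ModEq]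
      push_cast
      omega
    rw [show 7 * (M + 1) = 7 * M + 7 by ring, prod_range_add, ih, prod_range_succ _ M,
      prod_range_succ _ M]
    simp only [add_assoc, h, prod_range_succ, prod_range_zero]
    have h1 : IsAllowedPart (0 + 1) := by decide
    have h2 : IsAllowedPart (1 + 1) := by decide
    have h3 : ¬ IsAllowedPart (2 + 1) := by decide
    have h4 : ¬ IsAllowedPart (3 + 1) := by decide
    have h5 : IsAllowedPart (4 + 1) := by decide
    have h6 : IsAllowedPart (5 + 1) := by decide
    have h7 : ¬ IsAllowedPart (6 + 1) := by decide
    rw [if_pos h1, if_pos h2, if_neg h3, if_neg h4, if_pos h5, if_pos h6, if_neg h7]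
    ring

theorem mk_prod_range {R : Type*} [CommRing R] (p : ℕ → Prop) [DecidablePred p] {m M n : ℕ}
    (hM : m ≤ M) (hn : M ≤ n) :
    Ideal.Quotient.mk (Ideal.span {(X : R⟦X⟧) ^ m})
        (∏ i ∈ range n, (if p (i + 1) then 1 - X ^ (i + 1) else 1)) =
      Ideal.Quotient.mk (Ideal.span {(X : R⟦X⟧) ^ m})
        (∏ i ∈ range M, (if p (i + 1) then 1 - X ^ (i + 1) else 1)) := by
  induction n, hn using Nat.le_induction with
  | base => rfl
  | succ n hn ih =>
    rw [prod_range_succ, map_mul, ih]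
    split_ifs
    · rw [map_sub, map_one, mk_eq_zero_of_dvd (k := n + 1) (f := X ^ (n + 1)) (by omega) dvd_rfl,
        sub_zero, mul_one]
    · rw [map_one, mul_one]

theorem mk_card_restricted_mul_prod (R : Type*) [CommRing R] (p : ℕ → Prop) [DecidablePred p] {m M : ℕ} (hM : m ≤ M) :
    Ideal.Quotient.mk (Ideal.span {(X : R⟦X⟧) ^ m})
        (PowerSeries.mk fun n => ((Nat.Partition.restricted n p).card : R)) *
      Ideal.Quotient.mk (Ideal.span {(X : R⟦X⟧) ^ m})
        (∏ i ∈ range M, (if p (i + 1) then 1 - X ^ (i + 1) else 1)) = 1 := by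
  -- With discrete coefficients, convergence of the product means that each coefficient is
  -- eventually constant.
  let _ : TopologicalSpace R := ⊥
  have _ : DiscreteTopology R := ⟨rfl⟩
  open scoped PowerSeries.WithPiTopology in
  have h := (Nat.Partition.hasProd_powerSeriesMk_card_restricted R p).tendsto_prod_nat
  open scoped PowerSeries.WithPiTopology in
  have hcoeff : ∀ k, ∀ᶠ n in Filter.atTop,
      coeff k (∏ i ∈ range n, (if p (i + 1) then ∑' j : ℕ, (X : R⟦X⟧) ^ ((i + 1) * j) else 1)) =
      coeff k (PowerSeries.mk fun n => ((Nat.Partition.restricted n p).card : R)) := by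
    intro k
    have h' := ((PowerSeries.WithPiTopology.continuous_coeff R k).tendsto _).comp h
    rw [nhds_discrete, Filter.tendsto_pure] at h'
    exact h'
  open scoped PowerSeries.WithPiTopology in
  have hinv : ∀ n, (∏ i ∈ range n,
      (if p (i + 1) then ∑' j : ℕ, (X : R⟦X⟧) ^ ((i + 1) * j) else 1)) *
      (∏ i ∈ range n, (if p (i + 1) then 1 - X ^ (i + 1) else 1)) = 1 := by
    intro n
    rw [← prod_mul_distrib]
    refine prod_eq_one fun i _ => ?_
    split_ifs
    · simp_rw [pow_mul]
      exact PowerSeries.WithPiTopology.tsum_pow_mul_one_sub_of_constantCoeff_eq_zero (by simp)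
    · exact one_mul 1
  obtain ⟨n, hn, hMn⟩ := (((Filter.eventually_all_finset (range m)).2 fun k _ => hcoeff k).and
    (Filter.eventually_ge_atTop M)).exists
  rw [← mk_prod_range p hM hMn, ← (mk_eq_mk_iff_coeff m _ _).2
    fun k hk => hn k (Finset.mem_range.2 hk), ← map_mul, hinv, map_one]

end Product

/-! ### Assembling the identity modulo X^m. -/

theorem X_pow_dvd_doubleSumTerm (D : ℕ → ℚ⟦X⟧) (e : ℕ → ℕ) (N : ℕ) :
    X ^ N ∣ doubleSumTerm X D e N :=
  Dvd.dvd.mul_right (pow_dvd_pow X (Nat.le_self_pow two_ne_zero N)) _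

theorem X_pow_dvd_foldedTheta (s : ℕ) :
    (X : ℚ⟦X⟧) ^ s ∣ foldedTheta (X ^ 7) (X ^ 3) (X ^ 4) s := by
  unfold foldedTheta
  split_ifs with hs
  · simp [hs]
  · refine Dvd.dvd.mul_left (dvd_add ?_ ?_) _
    · rw [← pow_mul]
      exact pow_dvd_pow X (by omega)
    · rw [← pow_mul]
      exact pow_dvd_pow X (by omega)

theorem mk_sum_doubleSumTerm (m : ℕ) :
    ∑ N ∈ range (m + m + 1), Ideal.Quotient.mk (Ideal.span {(X : ℚ⟦X⟧) ^ m})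
        (doubleSumTerm X (invQFactorial X) (fun j => j ^ 2) N) =
      Ideal.Quotient.mk (Ideal.span {(X : ℚ⟦X⟧) ^ m})
        (PowerSeries.mk fun n => (A73 n : ℚ)) := by
  set π := Ideal.Quotient.mk (Ideal.span {(X : ℚ⟦X⟧) ^ m}) with hπ
  have hX : (X : ℚ⟦X⟧) ≠ 0 := X_ne_zero
  have hD := isInvQFactorial_invQFactorial (q := X) (by simp)
  have hD7 := isInvQFactorial_invQFactorial (q := X ^ 7) (by simp)
  have hδ : ∀ k, m ≤ k → π (invQFactorial X k) = π (invQFactorial X m) := by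
    intro k hk
    have := mk_invQFactorial (b := 1) le_rfl hk
    rwa [pow_one] at this
  have hδ7 : ∀ k, m ≤ k → π (invQFactorial (X ^ 7) k) = π (invQFactorial (X ^ 7) m) :=
    fun k hk => mk_invQFactorial (by norm_num) hk
  have h1 := congrArg π (hD.sum_doubleSumTerm hX (m + m))
  rw [mk_sum_antidiagonal (X_pow_dvd_doubleSumTerm _ _) (G := fun _ k => invQFactorial X k)
      (fun _ => hδ),
    mk_sum_antidiagonal X_pow_dvd_foldedTheta
      (G := fun s k => invQFactorial X k * invQFactorial X (k + 2 * s))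
      (g := π (invQFactorial X m) * π (invQFactorial X m))
      (fun s k hk => by rw [map_mul, ← hπ, hδ k hk, hδ (k + 2 * s) (by omega)])] at h1
  have h2 := congrArg π (hD7.sum_foldedTheta (z := X ^ 3) (w := X ^ 4) (by ring)
    (pow_ne_zero 7 hX) (m + m))
  rw [mk_sum_antidiagonal X_pow_dvd_foldedTheta
      (G := fun s k => invQFactorial (X ^ 7) k * invQFactorial (X ^ 7) (k + 2 * s))
      (g := π (invQFactorial (X ^ 7) m) * π (invQFactorial (X ^ 7) m))
      (fun s k hk => by rw [map_mul, ← hπ, hδ7 k hk, hδ7 (k + 2 * s) (by omega)]), map_mul,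
      hδ7 (m + m + (m + m)) (by omega)] at h2
  have h3 := congrArg π (invQFactorial_mul_prod (q := X ^ 7) (by simp) (m + m))
  rw [map_mul, hδ7 (m + m) (by omega), map_one] at h3
  have h4 := congrArg π (invQFactorial_mul_prod (q := X) (by simp) (7 * (m + m)))
  have hsplit : ∏ i ∈ range (7 * (m + m)), (1 - (X : ℚ⟦X⟧) ^ (i + 1)) =
      (∏ i ∈ range (7 * (m + m)), (if IsAllowedPart (i + 1) then 1 - X ^ (i + 1) else 1)) *
      ∏ i ∈ range (7 * (m + m)), (if IsAllowedPart (i + 1) then 1 else 1 - X ^ (i + 1)) := by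
    rw [← prod_mul_distrib]
    refine prod_congr rfl fun i _ => ?_
    split_ifs <;> simp
  rw [hsplit, prod_not_isAllowedPart, map_mul, map_mul, map_mul, hδ (7 * (m + m)) (by omega),
    map_one] at h4
  have h5 := mk_card_restricted_mul_prod ℚ IsAllowedPart (m := m) (M := 7 * (m + m)) (by omega)
  change π (PowerSeries.mk fun n => (A73 n : ℚ)) * _ = 1 at h5
  rw [← hπ] at h1 h2 h5
  -- The relations are now Tδ = Θδ², Θε² = εB, εP = 1, δQPB = 1 and GQ = 1. They give Θ = PB, T = δΘ
  -- and T = G. The quotient may have zero divisors, so cancellation goes through these explicit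
  -- inverses.
  generalize ∑ N ∈ range (m + m + 1), π (doubleSumTerm X (invQFactorial X) (fun j => j ^ 2) N)
    = T at *
  generalize ∑ s ∈ range (m + m + 1), π (foldedTheta (X ^ 7) (X ^ 3) (X ^ 4) s) = Θ at *
  generalize π (PowerSeries.mk fun n => (A73 n : ℚ)) = G at *
  generalize π (invQFactorial X m) = δ at *
  generalize π (invQFactorial (X ^ 7) m) = ε at *
  generalize π (∏ j ∈ range (m + m), (1 - ((X : ℚ⟦X⟧) ^ 7) ^ (j + 1))) = P at *
  generalize π (∏ j ∈ range (m + m),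
    ((1 - (X : ℚ⟦X⟧) ^ 3 * (X ^ 7) ^ j) * (1 - X ^ 4 * (X ^ 7) ^ j))) = B at *
  generalize π (∏ i ∈ range (7 * (m + m)),
    (if IsAllowedPart (i + 1) then 1 - (X : ℚ⟦X⟧) ^ (i + 1) else 1)) = Q at *
  have hΘ : Θ = P * B := by
    linear_combination P ^ 2 * h2 + (P * B - Θ * (ε * P + 1)) * h3
  have hT : T = δ * Θ := by
    linear_combination (Q * (P * B)) * h1 + (δ * Θ - T) * h4
  linear_combination (-T) * h5 + G * (Q * hT + δ * Q * hΘ + h4)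

theorem A73_eq_sum_weight (n : ℕ) :
    A73 n = ∑ p : n.Partition with IsRogersRamanujan p, weight p := by
  -- The modulus X^(n+1) is the smallest that retains the coefficient of X^n.
  have h := mk_sum_doubleSumTerm (n + 1)
  rw [← map_sum, mk_eq_mk_iff_coeff] at h
  have h' := h n (Nat.lt_succ_self n)
  rw [map_sum, coeff_mk] at h'
  have hD := isInvQFactorial_invQFactorial (q := X) (by simp)
  simp only [← (rrSeries_eq_doubleSumTerm hD _).1, rrSeries, coeff_mk] at h'
  rw [sum_weight_eq_sum_rrLists (M := n + 1 + (n + 1) + 1) (by omega)]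
  exact_mod_cast h'.symm

end RogersRamanujan

theorem theorem5 (n : ℕ) :
    RogersRamanujan.A73 n =
      ∑ p : n.Partition with RogersRamanujan.IsRogersRamanujan p, RogersRamanujan.weight p := by
  exact RogersRamanujan.A73_eq_sum_weight n
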